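/- Let $\alpha>0$, $\beta>0$, let $n\ge 0$ be an integer, and let $A,B$ be real constants with $A\ge 0$, $A+B\ge 0$, not both zero. Let $\theta$ be the Heaviside step function and, for $t\in[0,1]$, put $$\mu_i(t)=\int_0^1 x^{i}\,x^{\alpha}(1-x)^{\beta}\bigl(A+B\,\theta(x-t)\bigr)\,dx\quad(i=0,1,2,\dots),\qquad D_n(t)=\det\bigl(\mu_{i+j}(t)\bigr)_{i,j=0}^{n-1},$$ with $D_0=1$, and $$H_n(t)=t(t-1)\frac{d}{dt}\ln D_n(t),\qquad \sigma(t)=H_n(t)+d_1t+d_2,$$ where $$d_1=-n(n+\alpha+\beta)-\frac{(\alpha+\beta)^2}{4},\qquad d_2=\frac14\bigl[2n(n+\alpha+\beta)+\beta(\alpha+\beta)\bigr].$$ Then for every $t\in(0,1)$ the determinant $D_n(t)$ is positive and differentiable in $t$, $\sigma$ is twice differentiable at $t$, and $\sigma$ satisfies the Jimbo--Miwa--Okamoto $\sigma$-form of Painlevé VI $$\sigma'\{t(t-1)\sigma''\}^2+\{2\sigma'(t\sigma'-\sigma)-\sigma'^2-\nu_1\nu_2\nu_3\nu_4\}^2=(\sigma'+\nu_1^2)(\sigma'+\nu_2^2)(\sigma'+\nu_3^2)(\sigma'+\nu_4^2)$$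 with $$\nu_1=\frac{\alpha+\beta}{2},\qquad \nu_2=\frac{\beta-\alpha}{2},\qquad \nu_3=\nu_4=\frac{2n+\alpha+\beta}{2}.$$ In particular the equation does not depend on $A$ and $B$. If moreover $A+B>0$, then $D_n(0)>0$, $D_n$ is differentiable from the right at $0$, and $\sigma$ has the initial data $\sigma(0)=d_2$ and $\sigma'(0)=d_1$, where $\sigma'(0)$ is the right derivative of $\sigma$ at $0$ and also equals $\lim_{t\to0^+}\sigma'(t)$. -/

import Mathlib

open Filter Topology

namespace JacobiJump

noncomputable section

/-- The Heaviside step function `θ` (its value at the single point `0` plays no role below). -/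
def heaviside (x : ℝ) : ℝ := if 0 ≤ x then 1 else 0

/-- The perturbed Jacobi weight `x ^ α * (1 - x) ^ β * (A + B * θ (x - t))` on `[0, 1]`. -/
def weight (α β A B t x : ℝ) : ℝ :=
  x ^ α * (1 - x) ^ β * (A + B * heaviside (x - t))

/-- The moments `μ_i(t) = ∫₀¹ x ^ i * weight(x; t) dx`. -/
def moment (α β A B : ℝ) (i : ℕ) (t : ℝ) : ℝ :=
  ∫ x in (0 : ℝ)..1, x ^ i * weight α β A B t x

/-- The Hankel determinant `D_n(t) = det (μ_{i+j}(t))_{i,j=0}^{n-1}`. -/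
def hankelDet (α β A B : ℝ) (n : ℕ) (t : ℝ) : ℝ :=
  (Matrix.of fun i j : Fin n => moment α β A B ((i : ℕ) + (j : ℕ)) t).det

/-- `H_n(t) = t (t - 1) d/dt ln D_n(t)`. -/
def hankelH (α β A B : ℝ) (n : ℕ) (t : ℝ) : ℝ :=
  t * (t - 1) * deriv (fun s => Real.log (hankelDet α β A B n s)) t

/-- The constant `d₁`. -/
def dOne (α β : ℝ) (n : ℕ) : ℝ :=
  -((n : ℝ) * (n + α + β)) - (α + β) ^ 2 / 4

/-- The constant `d₂`. -/
def dTwo (α β : ℝ) (n : ℕ) : ℝ :=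
  (1 / 4) * (2 * (n : ℝ) * (n + α + β) + β * (α + β))

/-- `σ(t) = H_n(t) + d₁ t + d₂`. -/
def sigma (α β A B : ℝ) (n : ℕ) (t : ℝ) : ℝ :=
  hankelH α β A B n t + dOne α β n * t + dTwo α β n

/-- `f` is twice differentiable at `t` and satisfies there the Jimbo-Miwa-Okamoto
`σ`-form of Painlevé VI with parameters `ν₁, ν₂, ν₃, ν₄`. -/
def SatisfiesJMOSigmaPVI (ν₁ ν₂ ν₃ ν₄ : ℝ) (f : ℝ → ℝ) (t : ℝ) : Prop :=
  (∀ᶠ s in 𝓝 t, DifferentiableAt ℝ f s) ∧ DifferentiableAt ℝ (deriv f) t ∧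
    deriv f t * (t * (t - 1) * deriv (deriv f) t) ^ 2
        + (2 * deriv f t * (t * deriv f t - f t) - deriv f t ^ 2 - ν₁ * ν₂ * ν₃ * ν₄) ^ 2
      = (deriv f t + ν₁ ^ 2) * (deriv f t + ν₂ ^ 2) * (deriv f t + ν₃ ^ 2)
        * (deriv f t + ν₄ ^ 2)

end

end JacobiJump

/-!
Write `γ = α + β`, `f x = x ^ α (1 - x) ^ β` and `g = B f(t)`. Integration against the perturbed
weight is the functional `L p = A ∫₀¹ p f + B ∫ₜ¹ p f` on polynomials, and only three of its
properties matter: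

* positivity, `0 < L (p ^ 2)` for `p ≠ 0` (`isPosFunctional_jumpFunctional`);
* the Pearson identity `L (x (1 - x) p' + (1 + α - (2 + γ) x) p) = -g t (1 - t) p(t)`, which is
  integration by parts (`isPearson_jumpFunctional`);
* the deformation law `d/dt L p = -g p(t)` (`hasDerivAt_jumpFunctional`).

Let `P_k` be the monic orthogonal polynomials of `L`, `h_k` their squared norms and `K_n` the
Christoffel-Darboux kernel. The Hankel determinant is `h_0 ⋯ h_{n-1}`, and `h_k' = -g P_k(t) ^ 2`, so
`H_n = g t (1 - t) K_n(t, t)` (`det_hankel_eq_prod`, `hankelH_eq`).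

For `n ≥ 1` the Pearson identity turns `(P_n, P_{n-1})` into a solution of a Fuchsian system in `x`
with poles at `0`, `1` and `t` (`structure_relation_succ`, `structure_relation`); its residue at `t`
is nilpotent of rank at most one, with entries built from `P_n(t)` and `P_{n-1}(t)`. The residues at
`0` and at `1`, in the gauge of the polynomials themselves, annihilate the values of
`(P_n, P_{n-1})` there. These values are not both zero, so two determinants vanish. With `s` the
subleading coefficient of `P_n` and
`U = g P_n(t) P_{n-1}(t) / h_{n-1}`, `V = (2n + 1 + γ) (h_n / h_{n-1}) g P_{n-1}(t) ^ 2 / h_{n-1}`,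
`W = (2n - 1 + γ) g P_n(t) ^ 2 / h_{n-1}`, the two determinants give (`cdKernel_relations`)

* `H_n = -(2n + γ) s - n (n + α)`;
* `V + W` as a polynomial in `t`, `s`, `U`, `H_n`;
* `V W` as a polynomial in `t`, `s`, `U`, `V + W`.

The deformation law gives `s' = U` and `t (1 - t) U' = V - W` (`hasDerivAt_coeff_monicOP`,
`exists_hasDerivAt_mul_div_normSq`). Hence `H_n' = -(2n + γ) U` and
`t (1 - t) H_n'' = -(2n + γ) (V - W)`, and the `σ`-form of Painlevé VI is the identity
`(V - W) ^ 2 = (V + W) ^ 2 - 4 V W` written in terms of `σ` (`sigmaForm_of_relations`). No division by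
a possibly vanishing function of `t` occurs, so no genericity is needed.

At `t = 0`, when `A + B > 0`, the functional is still positive and all the data extend
differentiably, while `g` vanishes there because `α > 0`; this gives the initial data.
-/

namespace JacobiJump

section

open Polynomial

/-! ### Monic orthogonal polynomials of a positive functional -/

/-- Positive definiteness of the bilinear form `(p, q) ↦ L (p q)`. -/
def IsPosFunctional (L : ℝ[X] →ₗ[ℝ] ℝ) : Prop :=
  ∀ p : ℝ[X], p ≠ 0 → 0 < L (p * p)

/-- The monic orthogonal polynomials of `L`, by Gram-Schmidt. -/
noncomputable def monicOP (L : ℝ[X] →ₗ[ℝ] ℝ) (n : ℕ) : ℝ[X] :=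
  X ^ n - ∑ k : Fin n,
    C (L (X ^ n * monicOP L k) / L (monicOP L k * monicOP L k)) * monicOP L k
termination_by n
decreasing_by all_goals exact k.2

/-- The squared norm of the `n`-th monic orthogonal polynomial. -/
noncomputable def normSq (L : ℝ[X] →ₗ[ℝ] ℝ) (n : ℕ) : ℝ := L (monicOP L n * monicOP L n)

/-- The Christoffel-Darboux kernel of order `n` at the point `y`, as a polynomial in the other
variable. -/
noncomputable def cdKernel (L : ℝ[X] →ₗ[ℝ] ℝ) (n : ℕ) (y : ℝ) : ℝ[X] :=
  ∑ k ∈ Finset.range n, C ((monicOP L k).eval y / normSq L k) * monicOP L k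

variable {L : ℝ[X] →ₗ[ℝ] ℝ}

lemma monicOP_eq (L : ℝ[X] →ₗ[ℝ] ℝ) (n : ℕ) :
    monicOP L n = X ^ n - ∑ k ∈ Finset.range n,
      C (L (X ^ n * monicOP L k) / normSq L k) * monicOP L k := by
  rw [monicOP, Finset.sum_range]
  rfl

lemma map_C_mul (L : ℝ[X] →ₗ[ℝ] ℝ) (a : ℝ) (p : ℝ[X]) : L (C a * p) = a * L p := by
  rw [← smul_eq_C_mul, map_smul, smul_eq_mul]

lemma coeff_monicOP_and (L : ℝ[X] →ₗ[ℝ] ℝ) (n : ℕ) :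
    (monicOP L n).coeff n = 1 ∧ (monicOP L n).degree < (n + 1 : ℕ) := by
  induction n using Nat.strong_induction_on with
  | _ n ih =>
    have key : ∀ j, n ≤ j → (∑ k ∈ Finset.range n,
        C (L (X ^ n * monicOP L k) / normSq L k) * monicOP L k).coeff j = 0 := by
      intro j hj
      rw [finsetSum_coeff]
      refine Finset.sum_eq_zero fun k hk => ?_
      have hk := Finset.mem_range.1 hk
      rw [coeff_C_mul, (degree_lt_iff_coeff_zero _ _).1 (ih k hk).2 j (by omega), mul_zero]
    constructor
    · rw [monicOP_eq, coeff_sub, key n le_rfl]; simp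
    · rw [degree_lt_iff_coeff_zero]
      intro j hj
      rw [monicOP_eq, coeff_sub, key j (by omega), coeff_X_pow, if_neg (by omega), sub_zero]

@[simp] lemma coeff_monicOP_self (L : ℝ[X] →ₗ[ℝ] ℝ) (n : ℕ) : (monicOP L n).coeff n = 1 :=
  (coeff_monicOP_and L n).1

lemma degree_monicOP_lt (L : ℝ[X] →ₗ[ℝ] ℝ) (n : ℕ) : (monicOP L n).degree < (n + 1 : ℕ) :=
  (coeff_monicOP_and L n).2

lemma coeff_monicOP_of_lt (L : ℝ[X] →ₗ[ℝ] ℝ) {n j : ℕ} (h : n < j) :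
    (monicOP L n).coeff j = 0 :=
  (degree_lt_iff_coeff_zero _ _).1 (degree_monicOP_lt L n) j h

lemma monicOP_ne_zero (L : ℝ[X] →ₗ[ℝ] ℝ) (n : ℕ) : monicOP L n ≠ 0 := fun h => by
  simpa [h] using coeff_monicOP_self L n

lemma normSq_pos (hL : IsPosFunctional L) (n : ℕ) : 0 < normSq L n :=
  hL _ (monicOP_ne_zero L n)

lemma map_monicOP_mul_monicOP (hL : IsPosFunctional L) {n j : ℕ} (h : j < n) :
    L (monicOP L n * monicOP L j) = 0 := by
  induction n using Nat.strong_induction_on generalizing j with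
  | _ n ih =>
    have hne : ∀ k < n, k ≠ j → L (monicOP L k * monicOP L j) = 0 := by
      intro k hk hkj
      rcases lt_or_gt_of_ne hkj with h' | h'
      · rw [mul_comm]; exact ih j h h'
      · exact ih k hk h'
    rw [monicOP_eq, sub_mul, Finset.sum_mul, map_sub, map_sum,
      Finset.sum_eq_single j]
    · rw [mul_assoc, map_C_mul, ← normSq, div_mul_cancel₀ _ (normSq_pos hL j).ne', sub_self]
    · intro k hk hkj
      rw [mul_assoc, map_C_mul, hne k (Finset.mem_range.1 hk) hkj, mul_zero]
    · intro h'; exact absurd (Finset.mem_range.2 h) h'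

lemma map_monicOP_mul_of_degree_lt (hL : IsPosFunctional L) {n : ℕ} {r : ℝ[X]}
    (hr : r.degree < n) : L (monicOP L n * r) = 0 := by
  have hX : ∀ j < n, L (monicOP L n * X ^ j) = 0 := by
    intro j hj
    have e := monicOP_eq L j
    rw [eq_sub_iff_add_eq] at e
    rw [← e, mul_add, Finset.mul_sum, map_add, map_sum, map_monicOP_mul_monicOP hL hj, zero_add]
    refine Finset.sum_eq_zero fun k hk => ?_
    rw [mul_left_comm, map_C_mul,
      map_monicOP_mul_monicOP hL ((Finset.mem_range.1 hk).trans hj), mul_zero]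
  by_cases h0 : r = 0
  · simp [h0]
  rw [r.as_sum_range_C_mul_X_pow' ((natDegree_lt_iff_degree_lt h0).2 hr), Finset.mul_sum, map_sum]
  refine Finset.sum_eq_zero fun k hk => ?_
  rw [mul_left_comm, map_C_mul, hX k (Finset.mem_range.1 hk), mul_zero]

lemma degree_sub_C_mul_monicOP (L : ℝ[X] →ₗ[ℝ] ℝ) {n : ℕ} {r : ℝ[X]}
    (hr : r.degree < (n + 1 : ℕ)) : (r - C (r.coeff n) * monicOP L n).degree < n := by
  rw [degree_lt_iff_coeff_zero] at hr ⊢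
  intro j hj
  rcases hj.eq_or_lt with rfl | hj
  · simp
  · rw [coeff_sub, coeff_C_mul, hr j hj, coeff_monicOP_of_lt L hj]; simp

/-- Pairing with `P_n` reads off the coefficient of `x ^ n`. -/
lemma map_monicOP_mul (hL : IsPosFunctional L) {n : ℕ} {r : ℝ[X]}
    (hr : r.degree < (n + 1 : ℕ)) : L (monicOP L n * r) = r.coeff n * normSq L n := by
  have h := map_monicOP_mul_of_degree_lt hL (degree_sub_C_mul_monicOP L hr)
  rw [mul_sub, map_sub, mul_left_comm, map_C_mul, ← normSq] at h
  linarith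

/-- The pairing of `P_n` with a polynomial of degree at most `n + 1`. -/
lemma map_monicOP_mul_succ (hL : IsPosFunctional L) {n : ℕ} {r : ℝ[X]}
    (hr : r.degree < (n + 1 + 1 : ℕ)) : L (monicOP L n * r) =
      (r.coeff n - r.coeff (n + 1) * (monicOP L (n + 1)).coeff n) * normSq L n := by
  have h := map_monicOP_mul hL (degree_sub_C_mul_monicOP L hr)
  rw [mul_sub, map_sub, mul_left_comm, map_C_mul, mul_comm (monicOP L n) (monicOP L (n + 1)),
    map_monicOP_mul_monicOP hL n.lt_succ_self, coeff_sub, coeff_C_mul] at h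
  linarith

lemma eq_zero_of_map_mul_eq_zero (hL : IsPosFunctional L) {n : ℕ} {R : ℝ[X]}
    (hR : R.degree < n) (h : ∀ r : ℝ[X], r.degree < n → L (R * r) = 0) : R = 0 := by
  by_contra h0
  exact (hL R h0).ne' (h R hR)

lemma cdKernel_succ (L : ℝ[X] →ₗ[ℝ] ℝ) (n : ℕ) (y : ℝ) : cdKernel L (n + 1) y =
    cdKernel L n y + C ((monicOP L n).eval y / normSq L n) * monicOP L n :=
  Finset.sum_range_succ _ _

lemma degree_cdKernel_lt (L : ℝ[X] →ₗ[ℝ] ℝ) (n : ℕ) (y : ℝ) : (cdKernel L n y).degree < n := by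
  rw [degree_lt_iff_coeff_zero]
  intro j hj
  rw [cdKernel, finsetSum_coeff]
  refine Finset.sum_eq_zero fun k hk => ?_
  rw [coeff_C_mul, coeff_monicOP_of_lt L ((Finset.mem_range.1 hk).trans_le hj), mul_zero]

lemma coeff_cdKernel_succ (L : ℝ[X] →ₗ[ℝ] ℝ) (n : ℕ) (y : ℝ) :
    (cdKernel L (n + 1) y).coeff n = (monicOP L n).eval y / normSq L n := by
  rw [cdKernel_succ, coeff_add, (degree_lt_iff_coeff_zero _ _).1 (degree_cdKernel_lt L n y) n le_rfl]
  simp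

/-- The reproducing property of the Christoffel-Darboux kernel. -/
lemma map_cdKernel_mul (hL : IsPosFunctional L) (y : ℝ) {n : ℕ} {r : ℝ[X]}
    (hr : r.degree < n) : L (cdKernel L n y * r) = r.eval y := by
  induction n generalizing r with
  | zero =>
    have : r = 0 := by
      ext j; simpa using (degree_lt_iff_coeff_zero _ _).1 hr j (Nat.zero_le j)
    simp [this]
  | succ n ih =>
    have h1 := ih (degree_sub_C_mul_monicOP L hr)
    have h2 := map_monicOP_mul_of_degree_lt hL (degree_cdKernel_lt L n y)
    rw [mul_comm] at h2
    rw [mul_sub, map_sub, mul_left_comm, map_C_mul, h2] at h1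
    rw [cdKernel_succ, add_mul, map_add, mul_assoc, map_C_mul, map_monicOP_mul hL hr]
    have := (normSq_pos hL n).ne'
    simp only [eval_sub, eval_mul, eval_C] at h1
    field_simp
    linarith

/-- The Christoffel-Darboux formula. The difference of the two sides has degree at most `m` and is
orthogonal to all polynomials of degree at most `m`. -/
lemma sub_mul_cdKernel (hL : IsPosFunctional L) (m : ℕ) (y : ℝ) :
    (X - C y) * cdKernel L (m + 1) y = C ((normSq L m)⁻¹) *
      (C ((monicOP L m).eval y) * monicOP L (m + 1)
        - C ((monicOP L (m + 1)).eval y) * monicOP L m) := by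
  have hh := (normSq_pos hL m).ne'
  have hK := (degree_lt_iff_coeff_zero _ _).1 (degree_cdKernel_lt L (m + 1) y)
  rw [← sub_eq_zero]
  refine eq_zero_of_map_mul_eq_zero (n := m + 1) hL ?_ ?_
  · rw [degree_lt_iff_coeff_zero]
    intro j hj
    obtain ⟨j, rfl⟩ : ∃ i, j = i + 1 := ⟨j - 1, by omega⟩
    simp only [sub_mul, coeff_sub, coeff_C_mul, coeff_X_mul]
    rw [hK (j + 1) hj, coeff_monicOP_of_lt L (by omega : m < j + 1)]
    rcases (by omega : j = m ∨ m + 1 ≤ j) with rfl | hj'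
    · rw [coeff_cdKernel_succ, coeff_monicOP_self]; field_simp; ring
    · rw [hK j hj', coeff_monicOP_of_lt L (by omega : m + 1 < j + 1)]; ring
  · intro r hr
    have hr' := (degree_lt_iff_coeff_zero _ _).1 hr
    -- `(x - y) r` is a multiple of `P_{m+1}` plus a polynomial of degree at most `m`
    have hdeg : ((X - C y) * r - C (r.coeff m) * monicOP L (m + 1)).degree <
        ((m + 1 : ℕ) : WithBot ℕ) := by
      rw [degree_lt_iff_coeff_zero]
      intro j hj
      obtain ⟨j, rfl⟩ : ∃ i, j = i + 1 := ⟨j - 1, by omega⟩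
      simp only [sub_mul, coeff_sub, coeff_C_mul, coeff_X_mul]
      rw [hr' (j + 1) hj]
      rcases (by omega : j = m ∨ m + 1 ≤ j) with rfl | hj'
      · rw [coeff_monicOP_self]; ring
      · rw [hr' j hj', coeff_monicOP_of_lt L (by omega : m + 1 < j + 1)]; ring
    have h1 := map_cdKernel_mul hL y hdeg
    have h2 := map_monicOP_mul_of_degree_lt hL (degree_cdKernel_lt L (m + 1) y)
    rw [mul_comm] at h2
    rw [mul_sub, map_sub, mul_left_comm _ (C _), map_C_mul, h2] at h1
    simp only [eval_sub, eval_mul, eval_C, eval_X, sub_self, zero_mul, mul_zero, sub_zero,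
      zero_sub] at h1
    rw [sub_mul, map_sub, mul_comm (X - C y), mul_assoc, h1, mul_assoc (C _), map_C_mul, sub_mul,
      map_sub, mul_assoc (C _), mul_assoc (C _), map_C_mul, map_C_mul,
      map_monicOP_mul_of_degree_lt hL hr, map_monicOP_mul hL hr]
    field_simp
    ring

/-- Consecutive orthogonal polynomials have no common zero: at such a zero the
Christoffel-Darboux kernel would vanish identically. -/
lemma monicOP_not_both_zero (hL : IsPosFunctional L) (m : ℕ) (y : ℝ) :
    (monicOP L (m + 1)).eval y ≠ 0 ∨ (monicOP L m).eval y ≠ 0 := by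
  by_contra! h
  have h1 := sub_mul_cdKernel hL m y
  rw [h.1, h.2] at h1
  simp only [map_zero, zero_mul, sub_self, mul_zero, mul_eq_zero, X_sub_C_ne_zero, false_or] at h1
  have h2 := map_cdKernel_mul hL y (n := m + 1) (r := 1) (by
    rw [degree_one]; exact_mod_cast m.succ_pos)
  simp [h1] at h2

/-- The Hankel determinant of a positive functional is the product of the squared norms of its
monic orthogonal polynomials: the unitriangular matrix of their coefficients diagonalizes the Hankel
matrix. -/
lemma det_hankel_eq_prod (hL : IsPosFunctional L) (n : ℕ) :
    (Matrix.of fun i j : Fin n => L (X ^ ((i : ℕ) + (j : ℕ)))).det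
      = ∏ k ∈ Finset.range n, normSq L k := by
  set M : Matrix (Fin n) (Fin n) ℝ := Matrix.of fun i j : Fin n => L (X ^ ((i : ℕ) + (j : ℕ)))
  set T : Matrix (Fin n) (Fin n) ℝ := Matrix.of fun i j : Fin n => (monicOP L i).coeff j
  have hexp : ∀ i : Fin n, monicOP L i = ∑ k : Fin n, C (T i k) * X ^ (k : ℕ) := by
    intro i
    refine Eq.trans ?_ (Finset.sum_range fun k => C ((monicOP L i).coeff k) * X ^ k)
    refine as_sum_range_C_mul_X_pow' _ ?_
    refine (natDegree_lt_iff_degree_lt (monicOP_ne_zero L i)).2 ((degree_monicOP_lt L i).trans_le ?_)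
    exact_mod_cast i.2
  have hT : T.det = 1 := by
    rw [Matrix.det_of_isLowerTriangular]
    · simp [T]
    · intro i j hij
      exact coeff_monicOP_of_lt L (by simpa using hij)
  have hprod : T * M * T.transpose = Matrix.diagonal fun k : Fin n => normSq L k := by
    ext i j
    have : (T * M * T.transpose) i j = L (monicOP L i * monicOP L j) := by
      rw [hexp i, hexp j, Finset.sum_mul_sum, map_sum, Finset.sum_congr rfl fun _ _ => map_sum _ _ _,
        Finset.sum_comm, Matrix.mul_apply]
      refine Finset.sum_congr rfl fun l _ => ?_
      rw [Matrix.mul_apply, Finset.sum_mul]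
      refine Finset.sum_congr rfl fun k _ => ?_
      rw [Matrix.transpose_apply, mul_assoc (C _), map_C_mul, mul_left_comm (X ^ _), map_C_mul,
        ← pow_add]
      change T i k * M k l * T j l = T i k * (T j l * M k l)
      ring
    rw [this, Matrix.diagonal_apply]
    split_ifs with h
    · rw [h]; rfl
    · rcases lt_or_gt_of_ne (fun h' => h (Fin.ext h') : (i : ℕ) ≠ j) with h' | h'
      · rw [mul_comm]; exact map_monicOP_mul_monicOP hL h'
      · exact map_monicOP_mul_monicOP hL h'
  have := congrArg Matrix.det hprod
  rw [Matrix.det_mul, Matrix.det_mul, Matrix.det_transpose, hT, Matrix.det_diagonal] at this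
  rw [Finset.prod_range, ← this]
  ring

/-! ### Structure relations for a Jacobi weight with a jump -/

/-- The Pearson-type identity satisfied by a Jacobi weight with a jump at `t`: integration by parts
of `(x (1 - x) p w)'` leaves the single boundary term `c * p(t)` of the jump. -/
def IsPearson (L : ℝ[X] →ₗ[ℝ] ℝ) (α β t c : ℝ) : Prop :=
  ∀ p : ℝ[X], L (X * (1 - X) * derivative p + (C (1 + α) - C (2 + α + β) * X) * p) = -c * p.eval t

/-- The factor `X * p` makes the formula hold for `k = 0` too. -/
lemma coeff_X_mul_one_sub_X_mul_derivative (p : ℝ[X]) (k : ℕ) :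
    (X * (1 - X) * derivative p).coeff k = k * p.coeff k - (k - 1) * (X * p).coeff k := by
  have h : ∀ j : ℕ, (X * derivative p).coeff j = j * p.coeff j := by
    intro j
    cases j with
    | zero => simp
    | succ j => rw [coeff_X_mul, coeff_derivative]; push_cast; ring
  rw [show X * (1 - X) * derivative p = X * derivative p - X * (X * derivative p) by ring,
    coeff_sub, h]
  cases k with
  | zero => simp
  | succ k => rw [coeff_X_mul, coeff_X_mul, h]; push_cast; ring

lemma coeff_C_mul_X_mul (a : ℝ) (p : ℝ[X]) (k : ℕ) :
    (C a * X * p).coeff k = a * (X * p).coeff k := by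
  rw [mul_assoc, coeff_C_mul]

lemma degree_lt_coeff {n : ℕ} {r : ℝ[X]} (hr : r.degree < n) {j : ℕ} (h : n ≤ j) :
    r.coeff j = 0 :=
  (degree_lt_iff_coeff_zero _ _).1 hr j h

/-- Integration by parts against the perturbed Jacobi weight. -/
lemma IsPearson.map_derivative_mul {α β t c : ℝ} (h : IsPearson L α β t c) (p r : ℝ[X]) :
    L (X * (1 - X) * derivative p * r) =
      -L (p * (X * (1 - X) * derivative r + (C (1 + α) - C (2 + α + β) * X) * r))
        - c * p.eval t * r.eval t := by
  have h1 := h (p * r)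
  rw [eval_mul, derivative_mul, show X * (1 - X) * (derivative p * r + p * derivative r) +
    (C (1 + α) - C (2 + α + β) * X) * (p * r) = X * (1 - X) * derivative p * r +
    p * (X * (1 - X) * derivative r + (C (1 + α) - C (2 + α + β) * X) * r) by ring, map_add] at h1
  linarith

/-- The structure relation for `P_n`, `n = m + 1`. The difference of the two sides has degree at most
`m` and is orthogonal to all polynomials of degree at most `m`. -/
lemma structure_relation_succ (hL : IsPosFunctional L) {α β t c : ℝ} (h : IsPearson L α β t c)
    (m : ℕ) :
    X * (1 - X) * derivative (monicOP L (m + 1))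
      + C (c * (monicOP L (m + 1)).eval t) * cdKernel L (m + 1) t =
    (C (m + 1 + (monicOP L (m + 1)).coeff m) - C (m + 1 : ℝ) * X) * monicOP L (m + 1)
      + C ((2 * m + 3 + α + β) * (normSq L (m + 1) / normSq L m)) * monicOP L m := by
  have hh := (normSq_pos hL m).ne'
  set P := monicOP L (m + 1) with hP
  set p := monicOP L m with hp
  rw [← sub_eq_zero]
  refine eq_zero_of_map_mul_eq_zero (n := m + 1) hL ?_ ?_
  · rw [degree_lt_iff_coeff_zero]
    intro j hj
    obtain ⟨j, rfl⟩ : ∃ i, j = i + 1 := ⟨j - 1, by omega⟩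
    simp only [coeff_X_mul_one_sub_X_mul_derivative, coeff_C_mul_X_mul, sub_mul, coeff_sub,
          coeff_add, coeff_C_mul, coeff_X_mul]
    rw [degree_lt_coeff (degree_cdKernel_lt L (m + 1) t) hj, hp,
      coeff_monicOP_of_lt L (by omega : m < j + 1), hP]
    rcases (by omega : j = m ∨ j = m + 1 ∨ m + 1 < j) with rfl | rfl | hj'
    · rw [coeff_monicOP_self]; push_cast; ring
    · rw [coeff_monicOP_self, coeff_monicOP_of_lt L (by omega : m + 1 < m + 1 + 1)]
      push_cast; ring
    · rw [coeff_monicOP_of_lt L hj', coeff_monicOP_of_lt L (by omega : m + 1 < j + 1)]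
      ring
  · intro r hr
    have e1 : L (P * (X * (1 - X) * derivative r + (C (1 + α) - C (2 + α + β) * X) * r)) =
        -(m + 2 + α + β) * r.coeff m * normSq L (m + 1) := by
      rw [hP, map_monicOP_mul hL]
      · congr 1
        simp only [coeff_X_mul_one_sub_X_mul_derivative, coeff_C_mul_X_mul, sub_mul, coeff_sub,
          coeff_add, coeff_C_mul, coeff_X_mul]
        rw [degree_lt_coeff hr le_rfl]; push_cast; ring
      · rw [degree_lt_iff_coeff_zero]
        intro j hj
        obtain ⟨j, rfl⟩ : ∃ i, j = i + 1 := ⟨j - 1, by omega⟩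
        simp only [coeff_X_mul_one_sub_X_mul_derivative, coeff_C_mul_X_mul, sub_mul, coeff_sub,
          coeff_add, coeff_C_mul, coeff_X_mul]
        rw [degree_lt_coeff hr (by omega : m + 1 ≤ j + 1),
          degree_lt_coeff hr (by omega : m + 1 ≤ j)]; push_cast; ring
    have e2 : L (P * (X * r)) = r.coeff m * normSq L (m + 1) := by
      rw [hP, map_monicOP_mul hL, coeff_X_mul]
      rw [degree_lt_iff_coeff_zero]
      intro j hj
      obtain ⟨j, rfl⟩ : ∃ i, j = i + 1 := ⟨j - 1, by omega⟩
      rw [coeff_X_mul, degree_lt_coeff hr (by omega : m + 1 ≤ j)]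
    have e3 : L (P * r) = 0 := map_monicOP_mul_of_degree_lt hL hr
    have e4 := map_monicOP_mul hL hr
    have e5 := map_cdKernel_mul hL t hr
    have e6 := h.map_derivative_mul P r
    rw [e1] at e6
    rw [sub_mul, map_sub, add_mul, map_add, add_mul, map_add, e6, mul_assoc (C _) _ r, map_C_mul,
      e5, mul_assoc (C _) _ r, map_C_mul, e4, show (C (m + 1 + P.coeff m) - C (m + 1 : ℝ) * X) * P * r
        = C (m + 1 + P.coeff m) * (P * r) - C (m + 1 : ℝ) * (P * (X * r)) by ring,
      map_sub, map_C_mul, map_C_mul, e2, e3]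
    field_simp
    ring

/-- The structure relation for `P_{n-1}`, `n = m + 1`. It involves the kernel of order `n`, not
`n - 1`, so that both relations have the same singular part at `t`. -/
lemma structure_relation (hL : IsPosFunctional L) {α β t c : ℝ} (h : IsPearson L α β t c)
    (m : ℕ) :
    X * (1 - X) * derivative (monicOP L m)
      + C (c * (monicOP L m).eval t) * cdKernel L (m + 1) t =
    C (-(2 * m + 1 + α + β)) * monicOP L (m + 1)
      + (C (m + 1 + α + β) * X - C (m + 1 + α + (monicOP L (m + 1)).coeff m)) * monicOP L m := by
  have hh := (normSq_pos hL m).ne'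
  set P := monicOP L (m + 1) with hP
  set p := monicOP L m with hp
  have hpc : p.coeff m = 1 := coeff_monicOP_self L m
  have hpd : p.degree < (m + 1 : ℕ) := degree_monicOP_lt L m
  -- `S` is the subleading coefficient of `P_m`, and `0` for `m = 0`
  set S := (X * p).coeff m with hS
  have hXp : L (p * (X * p)) = (S - P.coeff m) * normSq L m := by
    rw [map_monicOP_mul_succ hL, coeff_X_mul, hpc, one_mul]
    rw [degree_lt_iff_coeff_zero]
    intro j hj
    obtain ⟨j, rfl⟩ : ∃ i, j = i + 1 := ⟨j - 1, by omega⟩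
    rw [coeff_X_mul, degree_lt_coeff hpd (by omega)]
  have hpp : L (p * p) = normSq L m := rfl
  have hder : L (p * (X * (1 - X) * derivative p)) =
      (m - (m - 1) * S + m * P.coeff m) * normSq L m := by
    rw [map_monicOP_mul_succ hL]
    · rw [coeff_X_mul_one_sub_X_mul_derivative, coeff_X_mul_one_sub_X_mul_derivative, coeff_X_mul,
        hpc, degree_lt_coeff hpd le_rfl, ← hS]
      push_cast; ring
    · rw [degree_lt_iff_coeff_zero]
      intro j hj
      obtain ⟨j, rfl⟩ : ∃ i, j = i + 1 := ⟨j - 1, by omega⟩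
      rw [coeff_X_mul_one_sub_X_mul_derivative, coeff_X_mul,
        degree_lt_coeff hpd (by omega : m + 1 ≤ j + 1),
        degree_lt_coeff hpd (by omega : m + 1 ≤ j)]; push_cast; ring
  have hparts := h.map_derivative_mul p p
  rw [show p * (X * (1 - X) * derivative p + (C (1 + α) - C (2 + α + β) * X) * p) =
    p * (X * (1 - X) * derivative p) + C (1 + α) * (p * p) - C (2 + α + β) * (p * (X * p)) by ring,
    map_sub, map_add, map_C_mul, map_C_mul, mul_comm _ p, hder, hXp, hpp] at hparts
  rw [← sub_eq_zero]
  set R := X * (1 - X) * derivative p + C (c * p.eval t) * cdKernel L (m + 1) t -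
    (C (-(2 * m + 1 + α + β)) * P
      + (C (m + 1 + α + β) * X - C (m + 1 + α + P.coeff m)) * p) with hR
  have hRd : R.degree < (m + 1 : ℕ) := by
    rw [degree_lt_iff_coeff_zero]
    intro j hj
    obtain ⟨j, rfl⟩ : ∃ i, j = i + 1 := ⟨j - 1, by omega⟩
    simp only [hR, coeff_X_mul_one_sub_X_mul_derivative, coeff_C_mul_X_mul, sub_mul, coeff_sub,
      coeff_add, coeff_C_mul, coeff_X_mul]
    rw [degree_lt_coeff (degree_cdKernel_lt L (m + 1) t) hj, degree_lt_coeff hpd hj]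
    rcases (by omega : j = m ∨ m + 1 ≤ j) with rfl | hj'
    · rw [hpc, hP, coeff_monicOP_self]; push_cast; ring
    · rw [degree_lt_coeff hpd hj', degree_lt_coeff (degree_monicOP_lt L (m + 1)) (by omega)]
      push_cast; ring
  have hRr : ∀ r : ℝ[X], L (R * r) = L (X * (1 - X) * derivative p * r)
      + c * p.eval t * L (cdKernel L (m + 1) t * r) + (2 * m + 1 + α + β) * L (P * r)
      - (m + 1 + α + β) * L (p * (X * r)) + (m + 1 + α + P.coeff m) * L (p * r) := by
    intro r
    rw [hR, show (X * (1 - X) * derivative p + C (c * p.eval t) * cdKernel L (m + 1) t -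
      (C (-(2 * m + 1 + α + β)) * P
        + (C (m + 1 + α + β) * X - C (m + 1 + α + P.coeff m)) * p)) * r =
      X * (1 - X) * derivative p * r + C (c * p.eval t) * (cdKernel L (m + 1) t * r)
      - C (-(2 * m + 1 + α + β)) * (P * r) - C (m + 1 + α + β) * (p * (X * r))
      + C (m + 1 + α + P.coeff m) * (p * r) by ring]
    simp only [L.map_add, L.map_sub, map_C_mul]
    ring
  -- integration by parts of `p * p'` determines the square `p(t) ^ 2` that the kernel contributes
  have hRp : L (R * p) = 0 := by
    rw [hRr, map_cdKernel_mul hL t hpd, map_monicOP_mul_of_degree_lt hL hpd, hXp, hpp,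
      mul_comm _ p, hder]
    linear_combination hparts
  refine eq_zero_of_map_mul_eq_zero hL hRd fun r hr => ?_
  have hr1 := degree_sub_C_mul_monicOP L hr
  set r1 := r - C (r.coeff m) * monicOP L m with hr1e
  have hr1d : r1.degree < (m + 1 : ℕ) := hr1.trans (by exact_mod_cast m.lt_succ_self)
  have hc1 : r1.coeff m = 0 := degree_lt_coeff hr1 le_rfl
  suffices L (R * r1) = 0 by
    rw [hr1e, mul_sub, map_sub, mul_left_comm, map_C_mul, ← hp, hRp] at this
    linarith
  have hXr : (X * r1).degree < ((m + 1 : ℕ) : WithBot ℕ) := by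
    rw [degree_lt_iff_coeff_zero]
    intro j hj
    obtain ⟨j, rfl⟩ : ∃ i, j = i + 1 := ⟨j - 1, by omega⟩
    rw [coeff_X_mul, degree_lt_coeff hr1 (by omega)]
  have e1 : L (p * (X * (1 - X) * derivative r1 + (C (1 + α) - C (2 + α + β) * X) * r1)) =
      -(m + 1 + α + β) * (X * r1).coeff m * normSq L m := by
    rw [hp, map_monicOP_mul hL]
    · congr 1
      simp only [coeff_X_mul_one_sub_X_mul_derivative, coeff_C_mul_X_mul, sub_mul, coeff_sub,
        coeff_add, coeff_C_mul, hc1]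
      ring
    · rw [degree_lt_iff_coeff_zero]
      intro j hj
      obtain ⟨j, rfl⟩ : ∃ i, j = i + 1 := ⟨j - 1, by omega⟩
      simp only [coeff_X_mul_one_sub_X_mul_derivative, coeff_C_mul_X_mul, sub_mul, coeff_sub,
          coeff_add, coeff_C_mul, coeff_X_mul]
      rw [degree_lt_coeff hr1 (by omega : m ≤ j + 1),
        degree_lt_coeff hr1 (by omega : m ≤ j)]; push_cast; ring
  rw [hRr, h.map_derivative_mul, e1, map_cdKernel_mul hL t hr1d,
    map_monicOP_mul_of_degree_lt hL hr1d, map_monicOP_mul hL hr1d, map_monicOP_mul hL hXr, hc1]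
  ring

/-! ### Algebraic relations at a fixed jump -/

/-- A `2 × 2` matrix with a nonzero kernel vector has vanishing determinant. -/
lemma mul_eq_mul_of_kernel {a b c d x y : ℝ} (h : x ≠ 0 ∨ y ≠ 0) (h1 : a * x + b * y = 0)
    (h2 : c * x + d * y = 0) : a * d = b * c := by
  have e1 : (a * d - b * c) * x = 0 := by linear_combination d * h1 - b * h2
  have e2 : (a * d - b * c) * y = 0 := by linear_combination a * h2 - c * h1
  rcases h with h | h
  · exact sub_eq_zero.1 ((mul_eq_zero.1 e1).resolve_right h)
  · exact sub_eq_zero.1 ((mul_eq_zero.1 e2).resolve_right h)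

/-- The algebraic relations at a fixed jump `t`, for `n = m + 1`: the structure relations, evaluated
at `0`, `1` and `t`. -/
lemma cdKernel_relations (hL : IsPosFunctional L) {α β t g : ℝ} (ht0 : t ≠ 0) (ht1 : t ≠ 1)
    (hP : IsPearson L α β t (g * (t * (1 - t)))) (m : ℕ) {n s U V W H : ℝ} (hn : n = m + 1)
    (hs : s = (monicOP L (m + 1)).coeff m)
    (hU : U = g * (monicOP L (m + 1)).eval t * (monicOP L m).eval t / normSq L m)
    (hV : V = (2 * n + 1 + α + β) * (normSq L (m + 1) / normSq L m) *
      (g * (monicOP L m).eval t ^ 2 / normSq L m))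
    (hW : W = (2 * n - 1 + α + β) * (g * (monicOP L (m + 1)).eval t ^ 2 / normSq L m))
    (hH : H = g * (t * (1 - t)) * (cdKernel L (m + 1) t).eval t) :
    H = V + W + (2 * n + 2 * s + α - (2 * n + α + β) * t) * U ∧
    H = -(2 * n + α + β) * s - n * (n + α) ∧
    V * W = ((n + s) * (n + s + α) + (2 * n + 2 * s + α) * (1 - t) * U + (1 - t) * (V + W))
      * U ^ 2 := by
  have hh := (normSq_pos hL m).ne'
  have ht1' : 1 - t ≠ 0 := sub_ne_zero.2 ht1.symm
  have r1 := structure_relation_succ hL hP m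
  have r2 := structure_relation hL hP m
  have r3 := sub_mul_cdKernel hL m t
  have z0 := monicOP_not_both_zero hL m 0
  have z1 := monicOP_not_both_zero hL m 1
  rw [← hs, ← hn] at r1
  rw [← hs, ← hn] at r2
  set P := monicOP L (m + 1)
  set p := monicOP L m
  set K := cdKernel L (m + 1) t
  set h := normSq L m
  set b := normSq L (m + 1) / h
  have hm : (m : ℝ) = n - 1 := by linarith
  have e1 : ∀ x, x * (1 - x) * (derivative P).eval x + g * (t * (1 - t)) * P.eval t * K.eval x =
      (n + s - n * x) * P.eval x + (2 * n + 1 + α + β) * b * p.eval x := by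
    intro x
    have := congrArg (eval x) r1
    simp only [eval_add, eval_sub, eval_mul, eval_C, eval_X, eval_one] at this
    rw [this, hm]; ring
  have e2 : ∀ x, x * (1 - x) * (derivative p).eval x + g * (t * (1 - t)) * p.eval t * K.eval x =
      -(2 * n - 1 + α + β) * P.eval x + ((n + α + β) * x - (n + α + s)) * p.eval x := by
    intro x
    have := congrArg (eval x) r2
    simp only [eval_add, eval_sub, eval_mul, eval_C, eval_X, eval_one] at this
    rw [this, hm]; ring
  have e3 : ∀ x, (x - t) * K.eval x = h⁻¹ * (p.eval t * P.eval x - P.eval t * p.eval x) := by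
    intro x
    simpa only [eval_sub, eval_mul, eval_C, eval_X] using congrArg (eval x) r3
  have e4 : K.eval t =
      h⁻¹ * (p.eval t * (derivative P).eval t - P.eval t * (derivative p).eval t) := by
    have := congrArg (fun r => eval t (derivative r)) r3
    simpa using this
  set q := P.eval t
  set pt := p.eval t
  have k0 : K.eval 0 = -(h⁻¹ * (pt * P.eval 0 - q * p.eval 0)) / t := by
    rw [← e3]; field_simp; ring
  have k1 : K.eval 1 = h⁻¹ * (pt * P.eval 1 - q * p.eval 1) / (1 - t) := by
    rw [← e3]; field_simp
  -- the residue matrix at `0` annihilates `(P_n(0), P_{n-1}(0))`, hence is singular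
  have c0 : (n + s + U * (1 - t)) * (-(n + α + s) - U * (1 - t)) =
      ((2 * n + 1 + α + β) * b - (1 - t) * g * q ^ 2 / h)
        * (-(2 * n - 1 + α + β) + (1 - t) * g * pt ^ 2 / h) := by
    have f1 := e1 0
    have f2 := e2 0
    rw [k0] at f1 f2
    refine mul_eq_mul_of_kernel z0 ?_ ?_
    · rw [hU]; field_simp at f1 ⊢; linear_combination -f1
    · rw [hU]; field_simp at f2 ⊢; linear_combination -f2
  -- likewise at `1`
  have c1 : (s - U * t) * (β - s + U * t) =
      ((2 * n + 1 + α + β) * b + t * g * q ^ 2 / h)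
        * (-(2 * n - 1 + α + β) - t * g * pt ^ 2 / h) := by
    have f1 := e1 1
    have f2 := e2 1
    rw [k1] at f1 f2
    refine mul_eq_mul_of_kernel z1 ?_ ?_
    · rw [hU]; field_simp at f1 ⊢; linear_combination -f1
    · rw [hU]; field_simp at f2 ⊢; linear_combination -f2
  have hUsq : U ^ 2 = (g * q ^ 2 / h) * (g * pt ^ 2 / h) := by rw [hU]; field_simp
  -- the term quadratic in `U` drops out because the residue at `t` has vanishing determinant
  have c0' : (2 * n + 1 + α + β) * b * (2 * n - 1 + α + β) =
      (n + s) * (n + s + α) + (2 * n + 2 * s + α) * (1 - t) * U + (1 - t) * (V + W) := by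
    rw [hV, hW]
    linear_combination c0 + (1 - t) ^ 2 * hUsq
  have c1' : (2 * n + 1 + α + β) * b * (2 * n - 1 + α + β) =
      s * (s - β) - (2 * s - β) * t * U - t * (V + W) := by
    rw [hV, hW]
    linear_combination c1 + t ^ 2 * hUsq
  have hHV : H = V + W + (2 * n + 2 * s + α - (2 * n + α + β) * t) * U := by
    have f1 := e1 t
    have f2 := e2 t
    rw [hH, e4, hV, hW, hU]
    field_simp
    linear_combination (g * pt) * f1 - (g * q) * f2
  refine ⟨hHV, ?_, ?_⟩
  · rw [hHV]; linear_combination c1' - c0'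
  · rw [← c0', hUsq, hV, hW]; ring

/-! ### Deformation in the position of the jump -/

/-- The curve of polynomials `P` has derivative `P'` at `t`, coefficient by coefficient. -/
def HasCoeffDerivAt (P : ℝ → ℝ[X]) (P' : ℝ[X]) (t : ℝ) : Prop :=
  ∀ i, HasDerivAt (fun τ => (P τ).coeff i) (P'.coeff i) t

lemma hasCoeffDerivAt_const (r : ℝ[X]) (t : ℝ) : HasCoeffDerivAt (fun _ => r) 0 t := by
  intro i; simpa using hasDerivAt_const t (r.coeff i)

lemma HasCoeffDerivAt.sub {P Q : ℝ → ℝ[X]} {P' Q' : ℝ[X]} {t : ℝ} (hP : HasCoeffDerivAt P P' t)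
    (hQ : HasCoeffDerivAt Q Q' t) : HasCoeffDerivAt (fun τ => P τ - Q τ) (P' - Q') t := by
  intro i
  simp only [coeff_sub]
  exact (hP i).sub (hQ i)

lemma HasCoeffDerivAt.sum {ι : Type*} {u : Finset ι} {P : ι → ℝ → ℝ[X]} {P' : ι → ℝ[X]} {t : ℝ}
    (h : ∀ k ∈ u, HasCoeffDerivAt (P k) (P' k) t) :
    HasCoeffDerivAt (fun τ => ∑ k ∈ u, P k τ) (∑ k ∈ u, P' k) t := by
  intro i
  simp only [finsetSum_coeff]
  exact HasDerivAt.fun_sum fun k hk => h k hk i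

lemma HasCoeffDerivAt.mul {P Q : ℝ → ℝ[X]} {P' Q' : ℝ[X]} {t : ℝ} (hP : HasCoeffDerivAt P P' t)
    (hQ : HasCoeffDerivAt Q Q' t) :
    HasCoeffDerivAt (fun τ => P τ * Q τ) (P' * Q t + P t * Q') t := by
  intro i
  simp only [coeff_add, coeff_mul, ← Finset.sum_add_distrib]
  exact HasDerivAt.fun_sum fun k _ => (hP k.1).mul (hQ k.2)

lemma hasCoeffDerivAt_C {f : ℝ → ℝ} {f' t : ℝ} (hf : HasDerivAt f f' t) :
    HasCoeffDerivAt (fun τ => C (f τ)) (C f') t := by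
  intro i
  simp only [coeff_C]
  split_ifs
  · exact hf
  · exact hasDerivAt_const _ _

lemma HasCoeffDerivAt.coeff_eq_zero {P : ℝ → ℝ[X]} {P' : ℝ[X]} {t a : ℝ} {i : ℕ}
    (hP : HasCoeffDerivAt P P' t) (h : ∀ τ, (P τ).coeff i = a) : P'.coeff i = 0 := by
  have := hP i
  simp only [h] at this
  exact this.unique (hasDerivAt_const t a)

lemma HasCoeffDerivAt.natDegree_le {P : ℝ → ℝ[X]} {P' : ℝ[X]} {t : ℝ} {N : ℕ}
    (hP : HasCoeffDerivAt P P' t) (h : ∀ τ, (P τ).natDegree ≤ N) : P'.natDegree ≤ N :=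
  natDegree_le_iff_coeff_eq_zero.2 fun _ hi =>
    hP.coeff_eq_zero fun τ => natDegree_le_iff_coeff_eq_zero.1 (h τ) _ hi

/-- The derivative of `τ ↦ P_τ(τ)`: the argument moves together with the polynomial. -/
lemma HasCoeffDerivAt.eval {P : ℝ → ℝ[X]} {P' : ℝ[X]} {t : ℝ} {N : ℕ}
    (hP : HasCoeffDerivAt P P' t) (h : ∀ τ, (P τ).natDegree ≤ N) :
    HasDerivAt (fun τ => (P τ).eval τ) (P'.eval t + (derivative (P t)).eval t) t := by
  have e1 : (fun τ => (P τ).eval τ) =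
      fun τ => ∑ i ∈ Finset.range (N + 1), (P τ).coeff i * τ ^ i := by
    funext τ
    exact eval_eq_sum_range' (Nat.lt_succ_of_le (h τ)) τ
  have e2 : (derivative (P t)).eval t =
      ∑ i ∈ Finset.range (N + 1), (P t).coeff i * (i * t ^ (i - 1)) := by
    conv_lhs => rw [(P t).as_sum_range_C_mul_X_pow' (Nat.lt_succ_of_le (h t))]
    simp only [derivative_sum, derivative_C_mul, derivative_X_pow, eval_finsetSum, eval_mul, eval_C,
      eval_pow, eval_X]
  rw [e1, e2, eval_eq_sum_range' (Nat.lt_succ_of_le (hP.natDegree_le h)), ← Finset.sum_add_distrib]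
  exact HasDerivAt.fun_sum fun i _ => (hP i).mul (hasDerivAt_pow i t)

lemma map_eq_sum (L : ℝ[X] →ₗ[ℝ] ℝ) {p : ℝ[X]} {N : ℕ} (h : p.natDegree ≤ N) :
    L p = ∑ i ∈ Finset.range (N + 1), p.coeff i * L (X ^ i) := by
  conv_lhs => rw [p.as_sum_range_C_mul_X_pow' (Nat.lt_succ_of_le h), map_sum]
  exact Finset.sum_congr rfl fun i _ => map_C_mul _ _ _

section deformation

variable {F : ℝ → ℝ[X] →ₗ[ℝ] ℝ} {t g : ℝ}

/-- The product rule for `τ ↦ F_τ(P_τ)` when `d/dτ F_τ(p) = -g p(t)`. -/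
lemma HasCoeffDerivAt.map (hF : ∀ p : ℝ[X], HasDerivAt (fun τ => F τ p) (-g * p.eval t) t)
    {P : ℝ → ℝ[X]} {P' : ℝ[X]} {N : ℕ}
    (hP : HasCoeffDerivAt P P' t) (h : ∀ τ, (P τ).natDegree ≤ N) :
    HasDerivAt (fun τ => F τ (P τ)) (F t P' - g * (P t).eval t) t := by
  have e1 : (fun τ => F τ (P τ)) =
      fun τ => ∑ i ∈ Finset.range (N + 1), (P τ).coeff i * F τ (X ^ i) := by
    funext τ
    exact map_eq_sum (F τ) (h τ)
  rw [e1, map_eq_sum (F t) (hP.natDegree_le h), eval_eq_sum_range' (Nat.lt_succ_of_le (h t)),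
    Finset.mul_sum, ← Finset.sum_sub_distrib]
  refine HasDerivAt.fun_sum fun i _ => ?_
  refine ((hP i).mul (hF (X ^ i))).congr_deriv ?_
  simp only [eval_pow, eval_X]
  ring

lemma natDegree_monicOP_le (L : ℝ[X] →ₗ[ℝ] ℝ) (n : ℕ) : (monicOP L n).natDegree ≤ n :=
  natDegree_le_iff_coeff_eq_zero.2 fun _ h => coeff_monicOP_of_lt L h

/-- Gram-Schmidt divides only by squared norms, so positivity at the single parameter `t` already
makes the orthogonal polynomials differentiable there; this is what is available at `t = 0`. -/
lemma exists_hasCoeffDerivAt_monicOP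
    (hF : ∀ p : ℝ[X], HasDerivAt (fun τ => F τ p) (-g * p.eval t) t)
    (hL : IsPosFunctional (F t)) (n : ℕ) :
    ∃ P', HasCoeffDerivAt (fun τ => monicOP (F τ) n) P' t := by
  induction n using Nat.strong_induction_on with
  | _ n ih =>
    have key : ∀ k ∈ Finset.range n, ∃ P', HasCoeffDerivAt (fun τ =>
        C (F τ (X ^ n * monicOP (F τ) k) / normSq (F τ) k) * monicOP (F τ) k) P' t := by
      intro k hk
      obtain ⟨Q, hQ⟩ := ih k (Finset.mem_range.1 hk)
      have h1 := ((hasCoeffDerivAt_const (X ^ n) t).mul hQ).map hF (N := n + k) fun τ =>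
        natDegree_mul_le_of_le (natDegree_X_pow_le n) (natDegree_monicOP_le _ k)
      have h2 := (hQ.mul hQ).map hF (N := k + k) fun τ =>
        natDegree_mul_le_of_le (natDegree_monicOP_le _ k) (natDegree_monicOP_le _ k)
      exact ⟨_, (hasCoeffDerivAt_C (h1.div h2 (normSq_pos hL k).ne')).mul hQ⟩
    choose! P' hP' using key
    refine ⟨0 - ∑ k ∈ Finset.range n, P' k, ?_⟩
    simp only [monicOP_eq _ n]
    exact (hasCoeffDerivAt_const _ _).sub (HasCoeffDerivAt.sum hP')

/-- The deformation equation `∂_t P_n(x) = g P_n(t) K_n(x, t)`: differentiating the orthogonality of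
`P_n` to lower degrees shows that `∂_t P_n` is, up to the factor `g P_n(t)`, the reproducing
kernel. -/
lemma hasCoeffDerivAt_monicOP
    (hF : ∀ p : ℝ[X], HasDerivAt (fun τ => F τ p) (-g * p.eval t) t)
    (hL : ∀ᶠ τ in 𝓝 t, IsPosFunctional (F τ)) (n : ℕ) :
    HasCoeffDerivAt (fun τ => monicOP (F τ) n)
      (C (g * (monicOP (F t) n).eval t) * cdKernel (F t) n t) t := by
  have hLt := hL.self_of_nhds
  obtain ⟨P', hP'⟩ := exists_hasCoeffDerivAt_monicOP hF hLt n
  have hdeg : P'.degree < n := by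
    rw [degree_lt_iff_coeff_zero]
    intro j hj
    rcases hj.eq_or_lt with rfl | hj
    · exact hP'.coeff_eq_zero fun τ => coeff_monicOP_self (F τ) n
    · exact hP'.coeff_eq_zero fun τ => coeff_monicOP_of_lt (F τ) hj
  suffices P' = C (g * (monicOP (F t) n).eval t) * cdKernel (F t) n t by rwa [← this]
  rw [← sub_eq_zero]
  refine eq_zero_of_map_mul_eq_zero (n := n) hLt ?_ fun r hr => ?_
  · rw [degree_lt_iff_coeff_zero]
    intro j hj
    rw [coeff_sub, coeff_C_mul, degree_lt_coeff hdeg hj,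
      degree_lt_coeff (degree_cdKernel_lt (F t) n t) hj]
    ring
  · have h1 := (hP'.mul (hasCoeffDerivAt_const r t)).map hF (N := n + r.natDegree) fun τ =>
      natDegree_mul_le_of_le (natDegree_monicOP_le _ n) le_rfl
    have h2 : (fun τ => F τ (monicOP (F τ) n * r)) =ᶠ[𝓝 t] fun _ => 0 := by
      filter_upwards [hL] with τ hτ using map_monicOP_mul_of_degree_lt hτ hr
    have h3 := h1.unique ((hasDerivAt_const t (0 : ℝ)).congr_of_eventuallyEq h2)
    rw [mul_zero, add_zero, eval_mul] at h3
    rw [sub_mul, map_sub, mul_assoc, map_C_mul, map_cdKernel_mul hLt t hr]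
    linarith

lemma differentiableAt_normSq
    (hF : ∀ p : ℝ[X], HasDerivAt (fun τ => F τ p) (-g * p.eval t) t)
    (hL : IsPosFunctional (F t)) (n : ℕ) : DifferentiableAt ℝ (fun τ => normSq (F τ) n) t := by
  obtain ⟨P', hP'⟩ := exists_hasCoeffDerivAt_monicOP hF hL n
  exact ((hP'.mul hP').map hF (N := n + n) fun τ =>
    natDegree_mul_le_of_le (natDegree_monicOP_le _ n) (natDegree_monicOP_le _ n)).differentiableAt

lemma continuousAt_eval_monicOP
    (hF : ∀ p : ℝ[X], HasDerivAt (fun τ => F τ p) (-g * p.eval t) t)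
    (hL : IsPosFunctional (F t)) (n : ℕ) :
    ContinuousAt (fun τ => (monicOP (F τ) n).eval τ) t := by
  obtain ⟨P', hP'⟩ := exists_hasCoeffDerivAt_monicOP hF hL n
  exact (hP'.eval fun τ => natDegree_monicOP_le _ n).continuousAt

lemma hasDerivAt_normSq
    (hF : ∀ p : ℝ[X], HasDerivAt (fun τ => F τ p) (-g * p.eval t) t)
    (hL : ∀ᶠ τ in 𝓝 t, IsPosFunctional (F τ)) (n : ℕ) :
    HasDerivAt (fun τ => normSq (F τ) n) (-g * (monicOP (F t) n).eval t ^ 2) t := by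
  have hP := hasCoeffDerivAt_monicOP hF hL n
  refine ((hP.mul hP).map hF (N := n + n) fun τ => natDegree_mul_le_of_le
    (natDegree_monicOP_le _ n) (natDegree_monicOP_le _ n)).congr_deriv ?_
  have h1 := map_monicOP_mul_of_degree_lt hL.self_of_nhds (degree_cdKernel_lt (F t) n t)
  have h2 := h1
  rw [mul_comm] at h2
  rw [map_add, mul_assoc, map_C_mul, mul_left_comm, map_C_mul, h1, h2, eval_mul]
  ring

/-- The logarithmic derivative of the Hankel determinant is the kernel on the diagonal. -/
lemma hasDerivAt_log_prod_normSq
    (hF : ∀ p : ℝ[X], HasDerivAt (fun τ => F τ p) (-g * p.eval t) t)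
    (hL : ∀ᶠ τ in 𝓝 t, IsPosFunctional (F τ)) (n : ℕ) :
    HasDerivAt (fun τ => Real.log (∏ k ∈ Finset.range n, normSq (F τ) k))
      (-g * (cdKernel (F t) n t).eval t) t := by
  have h1 : HasDerivAt (fun τ => ∑ k ∈ Finset.range n, Real.log (normSq (F τ) k))
      (-g * (cdKernel (F t) n t).eval t) t := by
    rw [cdKernel, eval_finsetSum, Finset.mul_sum]
    refine HasDerivAt.fun_sum fun k _ => ?_
    refine ((hasDerivAt_normSq hF hL k).log (normSq_pos hL.self_of_nhds k).ne').congr_deriv ?_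
    rw [eval_mul, eval_C]
    ring
  refine h1.congr_of_eventuallyEq ?_
  filter_upwards [hL] with τ hτ
  exact Real.log_prod fun k _ => (normSq_pos hτ k).ne'

/-- The derivative of the subleading coefficient of `P_n`, `n = m + 1`. -/
lemma hasDerivAt_coeff_monicOP
    (hF : ∀ p : ℝ[X], HasDerivAt (fun τ => F τ p) (-g * p.eval t) t)
    (hL : ∀ᶠ τ in 𝓝 t, IsPosFunctional (F τ)) (m : ℕ) :
    HasDerivAt (fun τ => (monicOP (F τ) (m + 1)).coeff m)
      (g * (monicOP (F t) (m + 1)).eval t * (monicOP (F t) m).eval t / normSq (F t) m) t := by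
  refine (hasCoeffDerivAt_monicOP hF hL (m + 1) m).congr_deriv ?_
  rw [coeff_C_mul, coeff_cdKernel_succ]
  ring

/-- The derivative of `g P_n(t) P_{n-1}(t) / h_{n-1}`, `n = m + 1`. The terms containing
`K_{n-1}(t, t)` in the velocities of `P_n(t)` and `P_{n-1}(t)` cancel against those of the structure
relations, and the trace of the Fuchsian system cancels against the logarithmic derivative of
`g`. -/
lemma exists_hasDerivAt_mul_div_normSq {α β : ℝ} {γ : ℝ → ℝ} {γ' : ℝ}
    (hF : ∀ p : ℝ[X], HasDerivAt (fun τ => F τ p) (-γ t * p.eval t) t)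
    (hL : ∀ᶠ τ in 𝓝 t, IsPosFunctional (F τ)) (ht1 : t ≠ 1)
    (hP : IsPearson (F t) α β t (γ t * (t * (1 - t))))
    (hγ : HasDerivAt γ γ' t) (hγ' : t * (1 - t) * γ' = (α - (α + β) * t) * γ t) (m : ℕ)
    {n : ℝ} (hn : n = m + 1) :
    ∃ U', HasDerivAt (fun τ => γ τ * (monicOP (F τ) (m + 1)).eval τ * (monicOP (F τ) m).eval τ
        / normSq (F τ) m) U' t ∧
      t * (1 - t) * U' = (2 * n + 1 + α + β) * (normSq (F t) (m + 1) / normSq (F t) m) *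
          (γ t * (monicOP (F t) m).eval t ^ 2 / normSq (F t) m)
        - (2 * n - 1 + α + β) *
          (γ t * (monicOP (F t) (m + 1)).eval t ^ 2 / normSq (F t) m) := by
  have hLt := hL.self_of_nhds
  have hh := (normSq_pos hLt m).ne'
  have ht1' : 1 - t ≠ 0 := sub_ne_zero.2 ht1.symm
  have dP := (hasCoeffDerivAt_monicOP hF hL (m + 1)).eval fun τ => natDegree_monicOP_le _ _
  have dp := (hasCoeffDerivAt_monicOP hF hL m).eval fun τ => natDegree_monicOP_le _ _
  have dh := hasDerivAt_normSq hF hL m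
  refine ⟨_, ((hγ.mul dP).mul dp).div dh hh, ?_⟩
  have r1 := congrArg (Polynomial.eval t) (structure_relation_succ hLt hP m)
  have r2 := congrArg (Polynomial.eval t) (structure_relation hLt hP m)
  rw [cdKernel_succ] at r1 r2
  rw [cdKernel_succ]
  have hm : (m : ℝ) = n - 1 := by linarith
  simp only [eval_add, eval_sub, eval_mul, eval_C, eval_X, eval_one, Pi.mul_apply, hm] at r1 r2 ⊢
  set q := (monicOP (F t) (m + 1)).eval t
  set p := (monicOP (F t) m).eval t
  set q' := (derivative (monicOP (F t) (m + 1))).eval t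
  set p' := (derivative (monicOP (F t) m)).eval t
  set h := normSq (F t) m
  set b := normSq (F t) (m + 1)
  set k := (cdKernel (F t) m t).eval t
  set g := γ t
  field_simp at r1 r2 ⊢
  linear_combination p * q * h * hγ' + g * p * r1 + g * q * r2

end deformation

/-! ### The perturbed Jacobi functional -/

/-- The unperturbed Jacobi weight on `[0, 1]`. -/
noncomputable def jacobiWeight (α β x : ℝ) : ℝ := x ^ α * (1 - x) ^ β

lemma continuous_jacobiWeight {α β : ℝ} (hα : 0 < α) (hβ : 0 < β) :
    Continuous (jacobiWeight α β) :=
  (Real.continuous_rpow_const hα.le).mul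
    ((Real.continuous_rpow_const hβ.le).comp (continuous_const.sub continuous_id))

lemma jacobiWeight_pos {α β x : ℝ} (hx : x ∈ Set.Ioo (0 : ℝ) 1) : 0 < jacobiWeight α β x :=
  mul_pos (Real.rpow_pos_of_pos hx.1 _) (Real.rpow_pos_of_pos (sub_pos.2 hx.2) _)

lemma jacobiWeight_nonneg {α β x : ℝ} (hx : x ∈ Set.Icc (0 : ℝ) 1) : 0 ≤ jacobiWeight α β x :=
  mul_nonneg (Real.rpow_nonneg hx.1 _) (Real.rpow_nonneg (sub_nonneg.2 hx.2) _)

lemma hasDerivAt_jacobiWeight (α β : ℝ) {x : ℝ} (hx : x ∈ Set.Ioo (0 : ℝ) 1) :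
    HasDerivAt (jacobiWeight α β)
      ((α - (α + β) * x) / (x * (1 - x)) * jacobiWeight α β x) x := by
  have h0 : x ≠ 0 := hx.1.ne'
  have h1 : 1 - x ≠ 0 := (sub_pos.2 hx.2).ne'
  have e1 := Real.hasDerivAt_rpow_const (p := α) (Or.inl h0)
  have e2 := ((hasDerivAt_id x).const_sub 1).rpow_const (p := β) (Or.inl h1)
  refine (e1.mul e2).congr_deriv ?_
  simp only [id, jacobiWeight]
  rw [Real.rpow_sub_one h0, Real.rpow_sub_one h1]
  field_simp
  ring

/-- The functional `p ↦ ∫ₐ¹ p(x) x ^ α (1 - x) ^ β dx` on polynomials. -/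
noncomputable def tailFunctional {α β : ℝ} (hα : 0 < α) (hβ : 0 < β) (a : ℝ) : ℝ[X] →ₗ[ℝ] ℝ where
  toFun p := ∫ x in a..1, p.eval x * jacobiWeight α β x
  map_add' p q := by
    simp only [eval_add, add_mul]
    exact intervalIntegral.integral_add
      ((p.continuous.mul (continuous_jacobiWeight hα hβ)).intervalIntegrable _ _)
      ((q.continuous.mul (continuous_jacobiWeight hα hβ)).intervalIntegrable _ _)
  map_smul' c p := by
    simp only [eval_smul, smul_eq_mul, mul_assoc, intervalIntegral.integral_const_mul,
      RingHom.id_apply]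

/-- Integration of polynomials against the perturbed Jacobi weight with jump at `t ∈ [0, 1]`,
written so that it stays differentiable in `t` across the end point `0`. -/
noncomputable def jumpFunctional {α β : ℝ} (hα : 0 < α) (hβ : 0 < β) (A B t : ℝ) :
    ℝ[X] →ₗ[ℝ] ℝ :=
  A • tailFunctional hα hβ 0 + B • tailFunctional hα hβ t

variable {α β : ℝ} (hα : 0 < α) (hβ : 0 < β) (A B : ℝ)

lemma jumpFunctional_apply (t : ℝ) (p : ℝ[X]) : jumpFunctional hα hβ A B t p =
    A * (∫ x in (0 : ℝ)..1, p.eval x * jacobiWeight α β x)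
      + B * ∫ x in t..1, p.eval x * jacobiWeight α β x := rfl

lemma hasDerivAt_jumpFunctional (p : ℝ[X]) (t : ℝ) :
    HasDerivAt (fun τ => jumpFunctional hα hβ A B τ p)
      (-(B * jacobiWeight α β t) * p.eval t) t := by
  have hc : Continuous fun x => p.eval x * jacobiWeight α β x :=
    p.continuous.mul (continuous_jacobiWeight hα hβ)
  have h := intervalIntegral.integral_hasDerivAt_left (hc.intervalIntegrable t 1)
    (hc.stronglyMeasurableAtFilter _ _) hc.continuousAt
  simp only [jumpFunctional_apply]
  refine ((h.const_mul B).const_add _).congr_deriv ?_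
  ring

lemma moment_eq_jumpFunctional {t : ℝ} (ht : t ∈ Set.Icc (0 : ℝ) 1) (i : ℕ) :
    moment α β A B i t = jumpFunctional hα hβ A B t (X ^ i) := by
  have hc : Continuous fun x => (X ^ i : ℝ[X]).eval x * jacobiWeight α β x :=
    (X ^ i : ℝ[X]).continuous.mul (continuous_jacobiWeight hα hβ)
  have hI : ∀ a b, IntervalIntegrable (fun x => (X ^ i : ℝ[X]).eval x * jacobiWeight α β x)
      MeasureTheory.volume a b := fun a b => hc.intervalIntegrable a b
  have e1 : Set.EqOn (fun x => A * ((X ^ i : ℝ[X]).eval x * jacobiWeight α β x))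
      (fun x => x ^ i * weight α β A B t x) (Set.uIoo 0 t) := by
    intro x hx
    rw [Set.uIoo_of_le ht.1] at hx
    have : ¬ 0 ≤ x - t := by linarith [hx.2]
    simp only [weight, heaviside, if_neg this, jacobiWeight, eval_pow, eval_X]
    ring
  have e2 : Set.EqOn (fun x => (A + B) * ((X ^ i : ℝ[X]).eval x * jacobiWeight α β x))
      (fun x => x ^ i * weight α β A B t x) (Set.uIoo t 1) := by
    intro x hx
    rw [Set.uIoo_of_le ht.2] at hx
    have : 0 ≤ x - t := by linarith [hx.1]
    simp only [weight, heaviside, if_pos this, jacobiWeight, eval_pow, eval_X]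
    ring
  rw [moment, ← intervalIntegral.integral_add_adjacent_intervals
    (((hI 0 t).const_mul A).congr_uIoo e1) (((hI t 1).const_mul (A + B)).congr_uIoo e2),
    ← intervalIntegral.integral_congr_uIoo e1, ← intervalIntegral.integral_congr_uIoo e2,
    intervalIntegral.integral_const_mul, intervalIntegral.integral_const_mul,
    jumpFunctional_apply, ← intervalIntegral.integral_add_adjacent_intervals (hI 0 t) (hI t 1)]
  ring

lemma integral_sq_mul_jacobiWeight_pos {α β : ℝ} (hα : 0 < α) (hβ : 0 < β)
    {a b : ℝ} (ha : 0 ≤ a) (hb : b ≤ 1) (hab : a < b)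
    {p : ℝ[X]} (hp : p ≠ 0) : 0 < ∫ x in a..b, (p * p).eval x * jacobiWeight α β x := by
  have hc : Continuous fun x => (p * p).eval x * jacobiWeight α β x :=
    (p * p).continuous.mul (continuous_jacobiWeight hα hβ)
  obtain ⟨x, hx, hpx⟩ : ∃ x ∈ Set.Ioo a b, p.eval x ≠ 0 := by
    by_contra! h
    exact hp (eq_zero_of_infinite_isRoot p ((Set.Ioo_infinite hab).mono fun x hx => h x hx))
  refine intervalIntegral.integral_pos hab hc.continuousOn (fun y hy => ?_)
    ⟨x, ⟨hx.1.le, hx.2.le⟩, ?_⟩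
  · rw [eval_mul]
    exact mul_nonneg (mul_self_nonneg _)
      (jacobiWeight_nonneg ⟨ha.trans hy.1.le, hy.2.trans hb⟩)
  · rw [eval_mul]
    exact mul_pos (mul_self_pos.2 hpx)
      (jacobiWeight_pos ⟨ha.trans_lt hx.1, hx.2.trans_le hb⟩)

variable {A B} in
lemma isPosFunctional_jumpFunctional (hA : 0 ≤ A) (hAB : 0 ≤ A + B) {t : ℝ} (ht0 : 0 ≤ t)
    (ht1 : t < 1) (h : 0 < A + B ∨ 0 < A ∧ 0 < t) :
    IsPosFunctional (jumpFunctional hα hβ A B t) := by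
  intro p hp
  have hI : ∀ a b, IntervalIntegrable (fun x => (p * p).eval x * jacobiWeight α β x)
      MeasureTheory.volume a b := fun a b =>
    ((p * p).continuous.mul (continuous_jacobiWeight hα hβ)).intervalIntegrable a b
  have e : jumpFunctional hα hβ A B t (p * p) =
      A * (∫ x in (0 : ℝ)..t, (p * p).eval x * jacobiWeight α β x)
      + (A + B) * ∫ x in t..1, (p * p).eval x * jacobiWeight α β x := by
    rw [jumpFunctional_apply,
      ← intervalIntegral.integral_add_adjacent_intervals (hI 0 t) (hI t 1)]
    ring
  have h1 := integral_sq_mul_jacobiWeight_pos hα hβ ht0 le_rfl ht1 hp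
  rw [e]
  rcases h with h | ⟨h, ht⟩
  · refine add_pos_of_nonneg_of_pos (mul_nonneg hA ?_) (mul_pos h h1)
    rcases ht0.eq_or_lt with rfl | ht
    · simp
    · exact (integral_sq_mul_jacobiWeight_pos hα hβ le_rfl ht1.le ht hp).le
  · exact add_pos_of_pos_of_nonneg
      (mul_pos h (integral_sq_mul_jacobiWeight_pos hα hβ le_rfl ht1.le ht hp))
      (mul_nonneg hAB h1.le)

lemma isPearson_jumpFunctional {t : ℝ} (ht : t ∈ Set.Icc (0 : ℝ) 1) :
    IsPearson (jumpFunctional hα hβ A B t) α β t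
      (B * jacobiWeight α β t * (t * (1 - t))) := by
  intro p
  have hw := continuous_jacobiWeight hα hβ
  have key : ∀ a ∈ Set.Icc (0 : ℝ) 1, ∫ x in a..1,
      (X * (1 - X) * derivative p + (C (1 + α) - C (2 + α + β) * X) * p).eval x *
        jacobiWeight α β x = -((X * (1 - X) * p).eval a * jacobiWeight α β a) := by
    intro a ha
    have hd : ∀ x ∈ Set.Ioo a 1, HasDerivAt
        (fun x => (X * (1 - X) * p).eval x * jacobiWeight α β x)
        ((X * (1 - X) * derivative p + (C (1 + α) - C (2 + α + β) * X) * p).eval x *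
          jacobiWeight α β x) x := by
      intro x hx
      have hx' : x ∈ Set.Ioo (0 : ℝ) 1 := ⟨ha.1.trans_lt hx.1, hx.2⟩
      have h0 : x ≠ 0 := hx'.1.ne'
      have h1 : 1 - x ≠ 0 := (sub_pos.2 hx'.2).ne'
      refine (((X * (1 - X) * p).hasDerivAt x).mul
        (hasDerivAt_jacobiWeight α β hx')).congr_deriv ?_
      simp only [derivative_mul, derivative_sub, derivative_X, derivative_one, eval_add, eval_sub,
        eval_mul, eval_C, eval_X, eval_one, eval_zero]
      field_simp
      ring
    rw [intervalIntegral.integral_eq_sub_of_hasDerivAt_of_le ha.2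
      ((X * (1 - X) * p).continuous.mul hw).continuousOn hd
      (((Polynomial.continuous _).mul hw).intervalIntegrable _ _)]
    simp
  rw [jumpFunctional_apply, key 0 (by simp), key t ht]
  simp only [eval_mul, eval_sub, eval_X, eval_one]
  ring

end

section

/-! ### The function `σ` and its Painlevé equation -/

variable {α β A B : ℝ}

/-- The `σ`-form of Painlevé VI is the identity `(V - W) ^ 2 = (V + W) ^ 2 - 4 V W`. -/
lemma sigmaForm_of_relations {n t s U V W H Y σ σ' σ'' : ℝ}
    (hs : H = -(2 * n + α + β) * s - n * (n + α))
    (hVW : H = V + W + (2 * n + 2 * s + α - (2 * n + α + β) * t) * U)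
    (hY : Y = (n + s) * (n + s + α) + (2 * n + 2 * s + α) * (1 - t) * U + (1 - t) * (V + W))
    (hmul : V * W = Y * U ^ 2)
    (hσ : σ = H + (-(n * (n + α + β)) - (α + β) ^ 2 / 4) * t
      + (1 / 4) * (2 * n * (n + α + β) + β * (α + β)))
    (hσ' : σ' = -(2 * n + α + β) * U + (-(n * (n + α + β)) - (α + β) ^ 2 / 4))
    (hσ'' : t * (t - 1) * σ'' = (2 * n + α + β) * (V - W)) :
    σ' * (t * (t - 1) * σ'') ^ 2 + (2 * σ' * (t * σ' - σ) - σ' ^ 2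
        - ((α + β) / 2) * ((β - α) / 2) * ((2 * n + α + β) / 2) * ((2 * n + α + β) / 2)) ^ 2
      = (σ' + ((α + β) / 2) ^ 2) * (σ' + ((β - α) / 2) ^ 2)
        * (σ' + ((2 * n + α + β) / 2) ^ 2) * (σ' + ((2 * n + α + β) / 2) ^ 2) := by
  have hVW' : V + W = H - (2 * n + 2 * s + α - (2 * n + α + β) * t) * U := by linarith
  have e : (V - W) ^ 2 = (V + W) ^ 2 - 4 * (Y * U ^ 2) := by rw [← hmul]; ring
  rw [hσ'', mul_pow, e, hY, hVW', hσ, hσ', hs]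
  ring

lemma hankelDet_eq_prod (hα : 0 < α) (hβ : 0 < β) {t : ℝ} (ht : t ∈ Set.Icc (0 : ℝ) 1)
    (hL : IsPosFunctional (jumpFunctional hα hβ A B t)) (n : ℕ) :
    hankelDet α β A B n t = ∏ k ∈ Finset.range n, normSq (jumpFunctional hα hβ A B t) k := by
  rw [← det_hankel_eq_prod hL, hankelDet]
  simp only [moment_eq_jumpFunctional hα hβ A B ht]

lemma eventually_isPosFunctional (hα : 0 < α) (hβ : 0 < β)
    (hA : 0 ≤ A) (hAB : 0 ≤ A + B) (hne : ¬ (A = 0 ∧ B = 0))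
    {t : ℝ} (ht : t ∈ Set.Ioo (0 : ℝ) 1) :
    ∀ᶠ τ in 𝓝 t, τ ∈ Set.Ioo (0 : ℝ) 1 ∧ IsPosFunctional (jumpFunctional hα hβ A B τ) := by
  filter_upwards [isOpen_Ioo.mem_nhds ht] with τ hτ
  refine ⟨hτ, isPosFunctional_jumpFunctional hα hβ hA hAB hτ.1.le hτ.2 ?_⟩
  rcases hAB.eq_or_lt with h | h
  · refine Or.inr ⟨lt_of_le_of_ne hA fun h' => hne ?_, hτ.1⟩
    constructor <;> linarith
  · exact Or.inl h

lemma hankelH_eq (hα : 0 < α) (hβ : 0 < β) (hA : 0 ≤ A) (hAB : 0 ≤ A + B) (hne : ¬ (A = 0 ∧ B = 0))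
    {t : ℝ} (ht : t ∈ Set.Ioo (0 : ℝ) 1) (n : ℕ) :
    hankelH α β A B n t = B * jacobiWeight α β t * (t * (1 - t)) *
      (cdKernel (jumpFunctional hα hβ A B t) n t).eval t := by
  have hev := eventually_isPosFunctional hα hβ hA hAB hne ht
  have h1 := hasDerivAt_log_prod_normSq (fun p => hasDerivAt_jumpFunctional hα hβ A B p t)
    (hev.mono fun _ h => h.2) n
  have h2 : (fun τ => Real.log (hankelDet α β A B n τ)) =ᶠ[𝓝 t] fun τ =>
      Real.log (∏ k ∈ Finset.range n, normSq (jumpFunctional hα hβ A B τ) k) := by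
    filter_upwards [hev] with τ hτ
    rw [hankelDet_eq_prod hα hβ ⟨hτ.1.1.le, hτ.1.2.le⟩ hτ.2]
  rw [hankelH, (h1.congr_of_eventuallyEq h2).deriv]
  ring

lemma hankelDet_pos (hα : 0 < α) (hβ : 0 < β) {t : ℝ} (ht : t ∈ Set.Icc (0 : ℝ) 1)
    (hL : IsPosFunctional (jumpFunctional hα hβ A B t)) (n : ℕ) : 0 < hankelDet α β A B n t := by
  rw [hankelDet_eq_prod hα hβ ht hL]
  exact Finset.prod_pos fun k _ => normSq_pos hL k

lemma differentiableAt_prod_normSq (hα : 0 < α) (hβ : 0 < β) {t : ℝ}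
    (hL : IsPosFunctional (jumpFunctional hα hβ A B t)) (n : ℕ) :
    DifferentiableAt ℝ
      (fun τ => ∏ k ∈ Finset.range n, normSq (jumpFunctional hα hβ A B τ) k) t :=
  DifferentiableAt.fun_finsetProd fun k _ =>
    differentiableAt_normSq (fun p => hasDerivAt_jumpFunctional hα hβ A B p t) hL k

lemma differentiableAt_hankelDet (hα : 0 < α) (hβ : 0 < β)
    (hA : 0 ≤ A) (hAB : 0 ≤ A + B) (hne : ¬ (A = 0 ∧ B = 0))
    {t : ℝ} (ht : t ∈ Set.Ioo (0 : ℝ) 1) (n : ℕ) :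
    DifferentiableAt ℝ (hankelDet α β A B n) t := by
  have hev := eventually_isPosFunctional hα hβ hA hAB hne ht
  refine (differentiableAt_prod_normSq hα hβ hev.self_of_nhds.2 n).congr_of_eventuallyEq ?_
  filter_upwards [hev] with τ hτ
  exact hankelDet_eq_prod hα hβ ⟨hτ.1.1.le, hτ.1.2.le⟩ hτ.2 n

/-- The logarithmic derivative of `D₀ = 1` vanishes. -/
lemma sigma_zero_left (α β A B t : ℝ) : sigma α β A B 0 t = dOne α β 0 * t + dTwo α β 0 := by
  simp [sigma, hankelH, hankelDet]

/-- The function `g P_n(t) P_{n-1}(t) / h_{n-1}` of `t`, `n = m + 1`, where `-g(t) p(t)` is the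
velocity of the perturbed Jacobi functional at `p`. -/
noncomputable def sigmaVelocity (hα : 0 < α) (hβ : 0 < β) (A B : ℝ) (m : ℕ) (t : ℝ) : ℝ :=
  B * jacobiWeight α β t * (monicOP (jumpFunctional hα hβ A B t) (m + 1)).eval t *
    (monicOP (jumpFunctional hα hβ A B t) m).eval t / normSq (jumpFunctional hα hβ A B t) m

/-- The relations between `H_n`, the subleading coefficient of `P_n` and the derivatives of the
latter, for `n = m + 1`; the constant `n` is a separate real variable so that either cast can be used. -/
lemma relations_jumpFunctional (hα : 0 < α) (hβ : 0 < β)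
    (hA : 0 ≤ A) (hAB : 0 ≤ A + B) (hne : ¬ (A = 0 ∧ B = 0))
    {t : ℝ} (ht : t ∈ Set.Ioo (0 : ℝ) 1) (m : ℕ) {n : ℝ} (hn : n = m + 1) :
    ∃ V W U', HasDerivAt (sigmaVelocity hα hβ A B m) U' t ∧ t * (1 - t) * U' = V - W ∧
      HasDerivAt (fun τ => (monicOP (jumpFunctional hα hβ A B τ) (m + 1)).coeff m)
        (sigmaVelocity hα hβ A B m t) t ∧
      ∀ s U H, s = (monicOP (jumpFunctional hα hβ A B t) (m + 1)).coeff m →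
        U = sigmaVelocity hα hβ A B m t → H = hankelH α β A B (m + 1) t →
        H = V + W + (2 * n + 2 * s + α - (2 * n + α + β) * t) * U ∧
        H = -(2 * n + α + β) * s - n * (n + α) ∧
        V * W = ((n + s) * (n + s + α) + (2 * n + 2 * s + α) * (1 - t) * U + (1 - t) * (V + W))
          * U ^ 2 := by
  have hev := (eventually_isPosFunctional hα hβ hA hAB hne ht).mono fun _ h => h.2
  have hL := hev.self_of_nhds
  have hF := fun p => hasDerivAt_jumpFunctional hα hβ A B p t
  have hP := isPearson_jumpFunctional hα hβ A B ⟨ht.1.le, ht.2.le⟩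
  have h0 : t ≠ 0 := ht.1.ne'
  have h1 : 1 - t ≠ 0 := (sub_pos.2 ht.2).ne'
  obtain ⟨U', hU', hVW⟩ := exists_hasDerivAt_mul_div_normSq
    (γ := fun τ => B * jacobiWeight α β τ) hF hev ht.2.ne hP
    ((hasDerivAt_jacobiWeight α β ht).const_mul B) (by field_simp) m hn
  refine ⟨_, _, U', hU', hVW, hasDerivAt_coeff_monicOP hF hev m, fun s U H hs hU hH => ?_⟩
  exact cdKernel_relations hL h0 ht.2.ne hP m hn hs hU rfl rfl
    (hH.trans (hankelH_eq hα hβ hA hAB hne ht _))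

lemma hasDerivAt_sigma (hα : 0 < α) (hβ : 0 < β)
    (hA : 0 ≤ A) (hAB : 0 ≤ A + B) (hne : ¬ (A = 0 ∧ B = 0))
    {t : ℝ} (ht : t ∈ Set.Ioo (0 : ℝ) 1) (m : ℕ) :
    HasDerivAt (sigma α β A B (m + 1))
      (-(2 * ((m + 1 : ℕ) : ℝ) + α + β) * sigmaVelocity hα hβ A B m t + dOne α β (m + 1)) t := by
  obtain ⟨_, _, _, _, _, hs, _⟩ := relations_jumpFunctional hα hβ hA hAB hne ht m rfl
  have h1 := ((hs.const_mul (-(2 * ((m + 1 : ℕ) : ℝ) + α + β))).sub_const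
    (((m + 1 : ℕ) : ℝ) * ((m + 1 : ℕ) + α))).add
    (((hasDerivAt_id t).const_mul (dOne α β (m + 1))).add_const (dTwo α β (m + 1)))
  refine (h1.congr_of_eventuallyEq ?_).congr_deriv (by ring)
  filter_upwards [isOpen_Ioo.mem_nhds ht] with τ hτ
  obtain ⟨_, _, _, _, _, _, h⟩ := relations_jumpFunctional hα hβ hA hAB hne hτ m
    (n := ((m + 1 : ℕ) : ℝ)) (by push_cast; rfl)
  have := (h _ _ _ rfl rfl rfl).2.1
  simp only [sigma, this, Pi.add_apply, id]
  ring

lemma satisfiesJMOSigmaPVI_sigma (hα : 0 < α) (hβ : 0 < β)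
    (hA : 0 ≤ A) (hAB : 0 ≤ A + B) (hne : ¬ (A = 0 ∧ B = 0))
    {t : ℝ} (ht : t ∈ Set.Ioo (0 : ℝ) 1) (n : ℕ) :
    SatisfiesJMOSigmaPVI ((α + β) / 2) ((β - α) / 2) ((2 * (n : ℝ) + α + β) / 2)
      ((2 * (n : ℝ) + α + β) / 2) (sigma α β A B n) t := by
  cases n with
  | zero =>
    have hd : ∀ τ, HasDerivAt (sigma α β A B 0) (dOne α β 0) τ := by
      intro τ
      rw [funext (sigma_zero_left α β A B)]
      simpa using ((hasDerivAt_id τ).const_mul (dOne α β 0)).add_const (dTwo α β 0)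
    have hd' : deriv (sigma α β A B 0) = fun _ => dOne α β 0 := funext fun τ => (hd τ).deriv
    refine ⟨Eventually.of_forall fun τ => (hd τ).differentiableAt, ?_, ?_⟩
    · rw [hd']; exact differentiableAt_const _
    · rw [hd', deriv_const, sigma_zero_left, dOne, dTwo]
      push_cast
      ring
  | succ m =>
    have hnhds := isOpen_Ioo.mem_nhds ht
    have hd' : deriv (sigma α β A B (m + 1)) =ᶠ[𝓝 t] fun τ =>
        -(2 * ((m + 1 : ℕ) : ℝ) + α + β) * sigmaVelocity hα hβ A B m τ + dOne α β (m + 1) := by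
      filter_upwards [hnhds] with τ hτ
      exact (hasDerivAt_sigma hα hβ hA hAB hne hτ m).deriv
    obtain ⟨V, W, U', hU', hVW, hs, h⟩ := relations_jumpFunctional hα hβ hA hAB hne ht m
      (n := ((m + 1 : ℕ) : ℝ)) (by push_cast; rfl)
    obtain ⟨e1, e2, e3⟩ := h _ _ _ rfl rfl rfl
    have hdd := ((hU'.const_mul (-(2 * ((m + 1 : ℕ) : ℝ) + α + β))).add_const
      (dOne α β (m + 1))).congr_of_eventuallyEq hd'
    refine ⟨?_, hdd.differentiableAt, ?_⟩
    · filter_upwards [hnhds] with τ hτ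
      exact (hasDerivAt_sigma hα hβ hA hAB hne hτ m).differentiableAt
    · refine sigmaForm_of_relations e2 e1 rfl e3 rfl hd'.self_of_nhds ?_
      rw [hdd.deriv]
      linear_combination (2 * ((m + 1 : ℕ) : ℝ) + α + β) * hVW

lemma jacobiWeight_zero (hα : 0 < α) (β : ℝ) : jacobiWeight α β 0 = 0 := by
  rw [jacobiWeight, Real.zero_rpow hα.ne', zero_mul]

lemma sigma_zero (α β A B : ℝ) (n : ℕ) : sigma α β A B n 0 = dTwo α β n := by
  simp [sigma, hankelH]

lemma hasDerivWithinAt_sigma_zero (hα : 0 < α) (hβ : 0 < β) (hA : 0 ≤ A) (hAB : 0 < A + B)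
    (n : ℕ) : HasDerivWithinAt (sigma α β A B n) (dOne α β n) (Set.Icc 0 1) 0 := by
  have hne : ¬ (A = 0 ∧ B = 0) := by rintro ⟨rfl, rfl⟩; simp at hAB
  have hL := isPosFunctional_jumpFunctional hα hβ hA hAB.le le_rfl one_pos (Or.inl hAB)
  have hF := fun p => hasDerivAt_jumpFunctional hα hβ A B p 0
  -- `H_n(τ) = τ φ(τ)` with `φ` continuous and vanishing at `0`
  set φ : ℝ → ℝ := fun τ => B * jacobiWeight α β τ * (1 - τ) *
    (cdKernel (jumpFunctional hα hβ A B τ) n τ).eval τ with hφ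
  have hφ0 : φ 0 = 0 := by simp [hφ, jacobiWeight_zero hα]
  have hcont : ContinuousAt φ 0 := by
    refine ((continuousAt_const.mul (continuous_jacobiWeight hα hβ).continuousAt).mul
      (continuousAt_const.sub continuousAt_id)).mul ?_
    simp only [cdKernel, Polynomial.eval_finsetSum, Polynomial.eval_mul, Polynomial.eval_C]
    refine tendsto_finsetSum _ fun k _ => ?_
    have h1 := continuousAt_eval_monicOP hF hL k
    exact (h1.div (differentiableAt_normSq hF hL k).continuousAt (normSq_pos hL k).ne').mul h1
  have h1 : HasDerivAt (fun τ => τ * φ τ) 0 0 := by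
    rw [hasDerivAt_iff_tendsto_slope]
    have h2 : Tendsto φ (𝓝[≠] 0) (𝓝 0) := by
      have := hcont.tendsto
      rw [hφ0] at this
      exact this.mono_left nhdsWithin_le_nhds
    refine h2.congr' ?_
    filter_upwards [self_mem_nhdsWithin] with τ hτ
    have : τ ≠ 0 := hτ
    simp [slope_def_field, this]
  have h2 : HasDerivAt (fun τ => τ * φ τ + (dOne α β n * τ + dTwo α β n)) (dOne α β n) 0 := by
    refine (h1.add (((hasDerivAt_id (0 : ℝ)).const_mul (dOne α β n)).add_const
      (dTwo α β n))).congr_deriv ?_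
    ring
  have hmem : Set.Iio (1 : ℝ) ∈ 𝓝[Set.Icc 0 1] (0 : ℝ) :=
    mem_nhdsWithin_of_mem_nhds (Iio_mem_nhds one_pos)
  refine h2.hasDerivWithinAt.congr_of_eventuallyEq ?_ ?_
  · filter_upwards [hmem, self_mem_nhdsWithin] with τ hτ1 hτ
    rcases hτ.1.eq_or_lt with rfl | h0
    · rw [sigma_zero]; simp
    · rw [sigma, hankelH_eq hα hβ hA hAB.le hne ⟨h0, hτ1⟩]
      ring
  · rw [sigma_zero]; simp

lemma tendsto_deriv_sigma_zero (hα : 0 < α) (hβ : 0 < β) (hA : 0 ≤ A) (hAB : 0 < A + B)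
    (n : ℕ) : Tendsto (deriv (sigma α β A B n)) (𝓝[>] 0) (𝓝 (dOne α β n)) := by
  cases n with
  | zero =>
    have hd' : deriv (sigma α β A B 0) = fun _ => dOne α β 0 := by
      funext τ
      rw [funext (sigma_zero_left α β A B)]
      simp
    rw [hd']
    exact tendsto_const_nhds
  | succ m =>
    have hne : ¬ (A = 0 ∧ B = 0) := by rintro ⟨rfl, rfl⟩; simp at hAB
    have hL := isPosFunctional_jumpFunctional hα hβ hA hAB.le le_rfl one_pos (Or.inl hAB)
    have hF := fun p => hasDerivAt_jumpFunctional hα hβ A B p 0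
    have hcont : ContinuousAt (sigmaVelocity hα hβ A B m) 0 :=
      (((continuousAt_const.mul (continuous_jacobiWeight hα hβ).continuousAt).mul
        (continuousAt_eval_monicOP hF hL (m + 1))).mul (continuousAt_eval_monicOP hF hL m)).div
        (differentiableAt_normSq hF hL m).continuousAt (normSq_pos hL m).ne'
    have h0 : sigmaVelocity hα hβ A B m 0 = 0 := by simp [sigmaVelocity, jacobiWeight_zero hα]
    have h1 : Tendsto (fun τ => -(2 * ((m + 1 : ℕ) : ℝ) + α + β) * sigmaVelocity hα hβ A B m τ
        + dOne α β (m + 1)) (𝓝[>] 0) (𝓝 (dOne α β (m + 1))) := by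
      have := ((hcont.tendsto.const_mul (-(2 * ((m + 1 : ℕ) : ℝ) + α + β))).add_const
        (dOne α β (m + 1))).mono_left (nhdsWithin_le_nhds (s := Set.Ioi 0))
      simpa only [h0, mul_zero, zero_add] using this
    refine h1.congr' ?_
    filter_upwards [Ioo_mem_nhdsGT (zero_lt_one' ℝ)] with τ hτ
    exact (hasDerivAt_sigma hα hβ hA hAB.le hne hτ m).deriv.symm

lemma differentiableWithinAt_hankelDet_zero (hα : 0 < α) (hβ : 0 < β) (hA : 0 ≤ A)
    (hAB : 0 < A + B) (n : ℕ) :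
    DifferentiableWithinAt ℝ (hankelDet α β A B n) (Set.Icc 0 1) 0 := by
  have hL : ∀ τ : ℝ, 0 ≤ τ → τ < 1 → IsPosFunctional (jumpFunctional hα hβ A B τ) :=
    fun τ h0 h1 => isPosFunctional_jumpFunctional hα hβ hA hAB.le h0 h1 (Or.inl hAB)
  have hmem : Set.Iio (1 : ℝ) ∈ 𝓝[Set.Icc 0 1] (0 : ℝ) :=
    mem_nhdsWithin_of_mem_nhds (Iio_mem_nhds one_pos)
  refine (differentiableAt_prod_normSq hα hβ (hL 0 le_rfl one_pos)
    n).differentiableWithinAt.congr_of_eventuallyEq ?_ ?_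
  · filter_upwards [hmem, self_mem_nhdsWithin] with τ hτ1 hτ
    exact hankelDet_eq_prod hα hβ hτ (hL τ hτ.1 hτ1) n
  · exact hankelDet_eq_prod hα hβ (by simp) (hL 0 le_rfl one_pos) n

end

end JacobiJump

/-- For `0 < t < 1` the determinant `D_n(t)` is positive and differentiable and
`σ` solves the `σ`-form of Painlevé VI; if moreover `A + B > 0`, then `D_n` is positive and
one-sidedly differentiable at `0` too, and `σ(0) = d₂`, `σ'(0) = d₁`, where `σ'(0)` is both the
one-sided derivative at `0` and the limit of `σ'(t)` as `t → 0+`. -/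
theorem mainTheorem1 (α β A B : ℝ) (n : ℕ) (hα : 0 < α) (hβ : 0 < β)
    (hA : 0 ≤ A) (hAB : 0 ≤ A + B) (hne : ¬ (A = 0 ∧ B = 0)) :
    (∀ t ∈ Set.Ioo (0 : ℝ) 1,
      0 < JacobiJump.hankelDet α β A B n t ∧
      DifferentiableAt ℝ (JacobiJump.hankelDet α β A B n) t ∧
      JacobiJump.SatisfiesJMOSigmaPVI ((α + β) / 2) ((β - α) / 2)
        ((2 * (n : ℝ) + α + β) / 2) ((2 * (n : ℝ) + α + β) / 2)
        (JacobiJump.sigma α β A B n) t) ∧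
    (0 < A + B →
      0 < JacobiJump.hankelDet α β A B n 0 ∧
      DifferentiableWithinAt ℝ (JacobiJump.hankelDet α β A B n) (Set.Icc 0 1) 0 ∧
      JacobiJump.sigma α β A B n 0 = JacobiJump.dTwo α β n ∧
      HasDerivWithinAt (JacobiJump.sigma α β A B n) (JacobiJump.dOne α β n) (Set.Icc 0 1) 0 ∧
      Tendsto (deriv (JacobiJump.sigma α β A B n)) (𝓝[>] 0) (𝓝 (JacobiJump.dOne α β n))) := by
  refine ⟨fun t ht => ⟨?_, ?_, ?_⟩, fun h => ⟨?_, ?_, ?_, ?_, ?_⟩⟩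
  · exact JacobiJump.hankelDet_pos hα hβ ⟨ht.1.le, ht.2.le⟩
      (JacobiJump.eventually_isPosFunctional hα hβ hA hAB hne ht).self_of_nhds.2 n
  · exact JacobiJump.differentiableAt_hankelDet hα hβ hA hAB hne ht n
  · exact JacobiJump.satisfiesJMOSigmaPVI_sigma hα hβ hA hAB hne ht n
  · exact JacobiJump.hankelDet_pos hα hβ (by simp)
      (JacobiJump.isPosFunctional_jumpFunctional hα hβ hA hAB le_rfl one_pos (Or.inl h)) n
  · exact JacobiJump.differentiableWithinAt_hankelDet_zero hα hβ hA h n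
  · exact JacobiJump.sigma_zero α β A B n
  · exact JacobiJump.hasDerivWithinAt_sigma_zero hα hβ hA h n
  · exact JacobiJump.tendsto_deriv_sigma_zero hα hβ hA h n
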